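/- Define subgroups $B_{2^n}\le S_{2^n}$ recursively by $B_1=\{1\}$ and $B_{2N}=(B_N\oplus B_N)\rtimes\langle (1\ 2)\otimes 1_N\rangle$, i.e. $B_{2N}$ is the group of all products $(\tau\otimes 1_N)(\sigma_1\oplus\sigma_2)$ with $\tau\in\langle(1\ 2)\rangle=S_2$ and $\sigma_1,\sigma_2\in B_N$; here $\oplus$ and $\otimes$ are the operations on permutations that correspond to the block-diagonal sum and the Kronecker product of permutation matrices (so $B_2=\langle(1\ 2)\rangle$). This is the group of nonsimple binary butterfly permutations; $B_{2^n}$ is a 2-Sylow subgroup of $S_{2^n}$ for every $n\ge 0$. Let $C(\sigma)$ denote the number of cycles (fixed points included) in the disjoint cycle decomposition of $\sigma$. Let $\lambda=\frac32$, and let $(m_k)_{k\ge1}$ be defined by $m_1=1$ and $$m_k=\frac{\lambda-1}{\lambda^k-\lambda}\sum_{j=1}^{k-1}\binom{k}{j}m_j\,m_{k-j}\qquad(k\ge2).$$ Theorem. There is a random variable $W$ with full support on $(0,\infty)$, that is, $\mathbb P(W\le 0)=0$ and $\mathbb P(W\in U)>0$ for every open set $U\subseteq\mathbb R$ that meets $(0,\infty)$,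 all of whose moments of positive integer order are finite and equal to $\mathbb E W^k=m_k$ for all integers $k\ge1$, such that the following holds: if for each $n$ the random permutation $\sigma_n$ is uniformly distributed on $B_{2^n}$, then $W_n=C(\sigma_n)\,(2/3)^n$ converges in distribution to $W$ as $n\to\infty$. -/

import Mathlib

open MeasureTheory ProbabilityTheory Filter Topology

namespace Butterfly

/-- The identification of `{0,1} × {0,…,2^n-1}` with `{0,…,2^(n+1)-1}` given by
`(b, i) ↦ 2^n * b + i`, i.e. by the two consecutive blocks of length `2^n`. -/
def blockEquiv (n : ℕ) : Fin 2 × Fin (2 ^ n) ≃ Fin (2 ^ (n + 1)) :=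
  finProdFinEquiv.trans (finCongr (pow_succ' 2 n).symm)

theorem blockEquiv_val (n : ℕ) (b : Fin 2) (i : Fin (2 ^ n)) :
    (blockEquiv n (b, i) : ℕ) = 2 ^ n * b + i := by
  simp [blockEquiv, add_comm]

/-- The direct sum `σ 0 ⊕ σ 1`: the permutation of `2^(n+1)` points that acts as `σ 0` on the
first block and as `σ 1` on the second block (its permutation matrix is block diagonal). -/
def directSum {n : ℕ} (σ : Fin 2 → Equiv.Perm (Fin (2 ^ n))) :
    Equiv.Perm (Fin (2 ^ (n + 1))) :=
  (blockEquiv n).permCongr (Equiv.prodCongrRight σ)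

/-- The Kronecker product `τ ⊗ σ`, acting as `τ` on the block index and as `σ` on the position
inside the block (its permutation matrix is the Kronecker product of those of `τ` and `σ`). -/
def kronecker {n : ℕ} (τ : Equiv.Perm (Fin 2)) (σ : Equiv.Perm (Fin (2 ^ n))) :
    Equiv.Perm (Fin (2 ^ (n + 1))) :=
  (blockEquiv n).permCongr (Equiv.prodCongr τ σ)

theorem directSum_mul {n : ℕ} (σ ρ : Fin 2 → Equiv.Perm (Fin (2 ^ n))) :
    directSum σ * directSum ρ = directSum (σ * ρ) := by
  ext x
  obtain ⟨⟨b, i⟩, rfl⟩ := (blockEquiv n).surjective x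
  simp [directSum, Equiv.permCongr_apply]

theorem directSum_one {n : ℕ} :
    directSum (1 : Fin 2 → Equiv.Perm (Fin (2 ^ n))) = 1 := by
  ext x
  obtain ⟨⟨b, i⟩, rfl⟩ := (blockEquiv n).surjective x
  simp [directSum, Equiv.permCongr_apply]

theorem kronecker_mul_one {n : ℕ} (τ υ : Equiv.Perm (Fin 2)) :
    kronecker τ (1 : Equiv.Perm (Fin (2 ^ n))) * kronecker υ 1 = kronecker (τ * υ) 1 := by
  ext x
  obtain ⟨⟨b, i⟩, rfl⟩ := (blockEquiv n).surjective x
  simp [kronecker, Equiv.permCongr_apply]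

theorem kronecker_one_one {n : ℕ} :
    kronecker 1 (1 : Equiv.Perm (Fin (2 ^ n))) = 1 := by
  ext x
  obtain ⟨⟨b, i⟩, rfl⟩ := (blockEquiv n).surjective x
  simp [kronecker, Equiv.permCongr_apply]

theorem directSum_mul_kronecker {n : ℕ} (σ : Fin 2 → Equiv.Perm (Fin (2 ^ n)))
    (τ : Equiv.Perm (Fin 2)) :
    directSum σ * kronecker τ 1 = kronecker τ 1 * directSum (fun b => σ (τ b)) := by
  ext x
  obtain ⟨⟨b, i⟩, rfl⟩ := (blockEquiv n).surjective x
  simp [directSum, kronecker, Equiv.permCongr_apply]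

/-- The internal semidirect product `(H ⊕ H) ⋊ ⟨(1 2) ⊗ 1⟩` inside `S_{2^(n+1)}`, for a subgroup
`H` of `S_{2^n}`: the group of all products `(τ ⊗ 1)(σ₀ ⊕ σ₁)` with `σ₀, σ₁ ∈ H` and
`τ ∈ ⟨(1 2)⟩`. -/
def blockExtension {n : ℕ} (H : Subgroup (Equiv.Perm (Fin (2 ^ n)))) :
    Subgroup (Equiv.Perm (Fin (2 ^ (n + 1)))) where
  carrier := {ρ | ∃ τ ∈ Subgroup.zpowers (Equiv.swap (0 : Fin 2) 1),
    ∃ σ : Fin 2 → Equiv.Perm (Fin (2 ^ n)), (∀ b, σ b ∈ H) ∧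
      ρ = kronecker τ 1 * directSum σ}
  one_mem' := ⟨1, one_mem _, 1, fun _ => one_mem _, by
    rw [directSum_one, kronecker_one_one, one_mul]⟩
  mul_mem' := by
    rintro _ _ ⟨τ, hτ, σ, hσ, rfl⟩ ⟨υ, hυ, ρ, hρ, rfl⟩
    refine ⟨τ * υ, mul_mem hτ hυ, (fun b => σ (υ b)) * ρ,
      fun b => mul_mem (hσ _) (hρ _), ?_⟩
    rw [← kronecker_mul_one, ← directSum_mul, mul_assoc, ← mul_assoc (directSum σ),
      directSum_mul_kronecker]
    simp only [mul_assoc]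
  inv_mem' := by
    rintro _ ⟨τ, hτ, σ, hσ, rfl⟩
    refine ⟨τ⁻¹, inv_mem hτ, fun b => (σ (τ⁻¹ b))⁻¹, fun b => inv_mem (hσ _), ?_⟩
    rw [inv_eq_iff_mul_eq_one, mul_assoc, ← mul_assoc (directSum σ), directSum_mul_kronecker,
      ← mul_assoc, ← mul_assoc, kronecker_mul_one, mul_assoc, directSum_mul]
    have h : ((fun b => σ (τ⁻¹ b)) * fun b => (σ (τ⁻¹ b))⁻¹) = 1 := by
      ext b x
      simp
    rw [h, directSum_one, mul_inv_cancel, kronecker_one_one, one_mul]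

/-- The group `B_N`, `N = 2^n`, of nonsimple binary butterfly permutations: `B_1 = {1}` and
`B_{2N} = (B_N ⊕ B_N) ⋊ ⟨(1 2) ⊗ 1_N⟩`. In particular `B_2 = ⟨(1 2)⟩ = S_2`. -/
def butterflyGroup : (n : ℕ) → Subgroup (Equiv.Perm (Fin (2 ^ n)))
  | 0 => ⊥
  | n + 1 => blockExtension (butterflyGroup n)

/-- `C(σ)`: the number of cycles in the disjoint cycle decomposition of `σ`, fixed points being
counted as cycles of length one; that is, the number of orbits of `σ`. -/
noncomputable def numCycles {k : ℕ} (σ : Equiv.Perm (Fin k)) : ℕ :=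
  Nat.card (Quotient (Equiv.Perm.SameCycle.setoid σ))

/-- The discrete σ-algebra on the finite set `S_k`. -/
instance instMeasurableSpacePerm (k : ℕ) : MeasurableSpace (Equiv.Perm (Fin k)) := ⊤

end Butterfly

namespace Butterfly

/-! On the coset of the identity the cycle count is `C(σ₀) + C(σ₁)`; on the coset of the swap it is
`C(σ₁σ₀)`, and `σ₁σ₀` is again uniform. So `C_{n+1}` is, with probability 1/2 each, a copy of `C_n`
or a sum of two independent copies: a Galton-Watson process with offspring 1 or 2 and mean `3/2`
(`cycleMean_succ`).

The characteristic functions of `W_n` thus satisfy `φ_{n+1}(t) = G(φ_n(2t/3))` with `G(z) = (z +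
z²)/2`, which is `3/2`-Lipschitz on the unit disc. The first increment is `O(t²)`, and each
iteration gains a factor `(2/3)²·(3/2) = 2/3`; hence the sequence is Cauchy, and Lévy's theorem
gives a limit law `ν`.

All moments of `W_n` are bounded in `n`, so they converge to those of `ν`, and their recursion
passes to the limit. The limit of the `φ`-recursion is a fixed point equation for `ν`: it forces the
mass at `0` to be `0` or `1` (the mean excludes `1`) and makes the support stable under `x ↦ 2x/3`
and `(x, y) ↦ 2(x + y)/3`, which fills `(0, ∞)`. -/

/-! ### Cycle counts of block permutations -/

theorem _root_.Function.Semiconj.perm_zpow {α β : Type*} {σ : Equiv.Perm α}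
    {ρ : Equiv.Perm β} {f : α → β} (h : Function.Semiconj f σ ρ) (k : ℤ) (x : α) :
    f ((σ ^ k) x) = (ρ ^ k) (f x) := by
  have h' : ∀ x, f (σ⁻¹ x) = ρ⁻¹ (f x) := fun x => by
    rw [Equiv.Perm.eq_inv_iff_eq, ← h.eq, ← Equiv.Perm.mul_apply, mul_inv_cancel, Equiv.Perm.one_apply]
  induction k using Int.induction_on generalizing x with
  | zero => simp
  | succ k ih =>
    rw [zpow_add_one, zpow_add_one, Equiv.Perm.mul_apply, Equiv.Perm.mul_apply, ih, h.eq]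
  | pred k ih =>
    rw [zpow_sub_one, zpow_sub_one, Equiv.Perm.mul_apply, Equiv.Perm.mul_apply, ih, h']

/-- The number of orbits of a permutation of an arbitrary type. -/
noncomputable def numOrbits {α : Type*} (σ : Equiv.Perm α) : ℕ :=
  Nat.card (Quotient (Equiv.Perm.SameCycle.setoid σ))

theorem numOrbits_permCongr {α β : Type*} (e : α ≃ β) (σ : Equiv.Perm α) :
    numOrbits (e.permCongr σ) = numOrbits σ := by
  have h : Function.Semiconj e σ (e.permCongr σ) := fun x => by simp [Equiv.permCongr_apply]
  refine (Nat.card_congr (Quotient.congr e fun x y => ?_)).symm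
  change Equiv.Perm.SameCycle _ _ _ ↔ Equiv.Perm.SameCycle _ _ _
  refine exists_congr fun k => ?_
  rw [← h.perm_zpow, e.apply_eq_iff_eq]

theorem numOrbits_prodCongrRight {ι α : Type*} [Fintype ι] [Finite α]
    (σ : ι → Equiv.Perm α) :
    numOrbits (Equiv.prodCongrRight σ) = ∑ b, numOrbits (σ b) := by
  have h : ∀ b, Function.Semiconj (Prod.mk b) (σ b) (Equiv.prodCongrRight σ) :=
    fun b x => by simp
  unfold numOrbits
  rw [← Nat.card_sigma]
  symm
  let s : (b : ι) → Setoid α := fun b => Equiv.Perm.SameCycle.setoid (σ b)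
  let t := Equiv.Perm.SameCycle.setoid (Equiv.prodCongrRight σ)
  let F : (Σ b, Quotient (s b)) → Quotient t := fun p =>
    Quotient.map' (s₁ := s p.1) (s₂ := t) (Prod.mk p.1)
      (fun x y ⟨k, hk⟩ => ⟨k, by rw [← (h p.1).perm_zpow, hk]⟩) p.2
  refine Nat.card_congr (Equiv.ofBijective F ⟨?_, ?_⟩)
  · rintro ⟨b, x⟩ ⟨c, y⟩ hxy
    induction x using Quotient.inductionOn' with | _ x => ?_
    induction y using Quotient.inductionOn' with | _ y => ?_
    obtain ⟨k, hk⟩ := Quotient.exact (s := t) hxy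
    rw [← (h b).perm_zpow, Prod.mk.injEq] at hk
    obtain ⟨rfl, hk⟩ := hk
    exact congrArg (Sigma.mk b) (Quotient.sound' ⟨k, hk⟩)
  · intro q
    induction q using Quotient.inductionOn' with | _ q => ?_
    exact ⟨⟨q.1, Quotient.mk'' q.2⟩, rfl⟩

/-- Every orbit meets block `0`, and the square of the permutation acts there as `σ 1 * σ 0`. -/
theorem numOrbits_swap_blocks {α : Type*} (σ : Fin 2 → Equiv.Perm α) :
    numOrbits (Equiv.prodCongr (Equiv.swap (0 : Fin 2) 1) (1 : Equiv.Perm α) *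
      Equiv.prodCongrRight σ) = numOrbits (σ 1 * σ 0) := by
  set ρ : Equiv.Perm (Fin 2 × α) :=
    Equiv.prodCongr (Equiv.swap (0 : Fin 2) 1) (1 : Equiv.Perm α) * Equiv.prodCongrRight σ
  have h0 : ∀ x, ρ (0, x) = (1, σ 0 x) := fun x => by simp [ρ]
  have h1 : ∀ x, ρ (1, x) = (0, σ 1 x) := fun x => by simp [ρ]
  have h : Function.Semiconj (Prod.mk (0 : Fin 2)) (σ 1 * σ 0 : Equiv.Perm α)
      (ρ ^ (2 : ℤ) : Equiv.Perm _) := fun x => by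
    rw [zpow_two, Equiv.Perm.mul_apply, Equiv.Perm.mul_apply, h0, h1]
  let s := Equiv.Perm.SameCycle.setoid (σ 1 * σ 0)
  let t := Equiv.Perm.SameCycle.setoid ρ
  let F : Quotient s → Quotient t := Quotient.map' (s₁ := s) (s₂ := t) (Prod.mk 0)
      (fun x y ⟨k, hk⟩ => ⟨2 * k, by rw [zpow_mul, ← h.perm_zpow, hk]⟩)
  refine (Nat.card_congr (Equiv.ofBijective F ⟨?_, ?_⟩)).symm
  · intro x y hxy
    induction x using Quotient.inductionOn' with | _ x => ?_
    induction y using Quotient.inductionOn' with | _ y => ?_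
    obtain ⟨k, hk⟩ := Quotient.exact (s := t) hxy
    -- Even powers preserve block `0` and are powers of `σ 1 * σ 0`; odd powers leave the block.
    obtain ⟨m, rfl | rfl⟩ := Int.even_or_odd' k
    · rw [zpow_mul, ← h.perm_zpow, Prod.mk.injEq] at hk
      exact Quotient.sound' ⟨m, hk.2⟩
    · rw [add_comm, zpow_one_add, Equiv.Perm.mul_apply, zpow_mul, ← h.perm_zpow, h0,
        Prod.mk.injEq] at hk
      exact absurd hk.1 one_ne_zero
  · intro q
    induction q using Quotient.inductionOn' with | _ q => ?_
    obtain ⟨b, x⟩ := q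
    fin_cases b
    · exact ⟨Quotient.mk'' x, rfl⟩
    · refine ⟨Quotient.mk'' (σ 1 x), Quotient.sound' ?_⟩
      exact Equiv.Perm.SameCycle.symm ⟨1, by rw [zpow_one]; exact h1 x⟩

theorem numCycles_directSum {n : ℕ} (σ : Fin 2 → Equiv.Perm (Fin (2 ^ n))) :
    numCycles (directSum σ) = numCycles (σ 0) + numCycles (σ 1) := by
  change numOrbits _ = _
  rw [directSum, numOrbits_permCongr, numOrbits_prodCongrRight, Fin.sum_univ_two]
  rfl

theorem numCycles_kronecker_swap_mul_directSum {n : ℕ}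
    (σ : Fin 2 → Equiv.Perm (Fin (2 ^ n))) :
    numCycles (kronecker (Equiv.swap 0 1) 1 * directSum σ) = numCycles (σ 1 * σ 0) := by
  change numOrbits _ = numOrbits _
  rw [← numOrbits_swap_blocks, ← numOrbits_permCongr (blockEquiv n)]
  congr 1
  ext x
  simp [kronecker, directSum, Equiv.permCongr_apply]

/-! ### Order of the butterfly group and the Sylow property -/

theorem zpowers_swap_eq_top : Subgroup.zpowers (Equiv.swap (0 : Fin 2) 1) = ⊤ := by
  rw [eq_top_iff]
  intro τ _
  have h : ∀ τ : Equiv.Perm (Fin 2), τ = 1 ∨ τ = Equiv.swap 0 1 := by decide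
  rcases h τ with rfl | rfl
  · exact one_mem _
  · exact Subgroup.mem_zpowers _

theorem kronecker_mul_directSum_apply {n : ℕ} (τ : Equiv.Perm (Fin 2))
    (σ : Fin 2 → Equiv.Perm (Fin (2 ^ n))) (b : Fin 2) (i : Fin (2 ^ n)) :
    (kronecker τ 1 * directSum σ : Equiv.Perm _) (blockEquiv n (b, i)) = blockEquiv n (τ b, σ b i) := by
  simp [kronecker, directSum, Equiv.permCongr_apply]

theorem kronecker_mul_directSum_injective (n : ℕ) :
    Function.Injective fun p : Equiv.Perm (Fin 2) × (Fin 2 → Equiv.Perm (Fin (2 ^ n))) =>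
      kronecker p.1 1 * directSum p.2 := by
  rintro ⟨τ, σ⟩ ⟨τ', σ'⟩ h
  have h' : ∀ b i, (τ b, σ b i) = (τ' b, σ' b i) := fun b i => by
    have := congrArg (fun f : Equiv.Perm _ => f (blockEquiv n (b, i))) h
    simp only [kronecker_mul_directSum_apply] at this
    exact (blockEquiv n).injective this
  refine Prod.ext (Equiv.ext fun b => ?_) (funext fun b => Equiv.ext fun i => ?_)
  · exact congrArg Prod.fst (h' b 0)
  · exact congrArg Prod.snd (h' b i)

/-- The decomposition of the elements of `B_{2N}` as products `(τ ⊗ 1)(σ₀ ⊕ σ₁)`. -/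
noncomputable def butterflyEquiv (n : ℕ) :
    Equiv.Perm (Fin 2) × (Fin 2 → butterflyGroup n) ≃ butterflyGroup (n + 1) :=
  Equiv.ofBijective
    (fun p => ⟨kronecker p.1 1 * directSum fun b => (p.2 b : Equiv.Perm (Fin (2 ^ n))),
      p.1, by simp [zpowers_swap_eq_top], _, fun b => (p.2 b).2, rfl⟩) (by
    constructor
    · rintro ⟨τ, σ⟩ ⟨τ', σ'⟩ h
      have := kronecker_mul_directSum_injective n (a₁ := (τ, fun b => ↑(σ b)))
        (a₂ := (τ', fun b => ↑(σ' b))) (congrArg Subtype.val h)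
      simp only [Prod.mk.injEq] at this
      exact Prod.ext this.1 (funext fun b => Subtype.ext (congrFun this.2 b))
    · rintro ⟨_, τ, _, σ, hσ, rfl⟩
      exact ⟨(τ, fun b => ⟨σ b, hσ b⟩), rfl⟩)

theorem butterflyEquiv_apply (n : ℕ) (p : Equiv.Perm (Fin 2) × (Fin 2 → butterflyGroup n)) :
    (butterflyEquiv n p : Equiv.Perm (Fin (2 ^ (n + 1)))) =
      kronecker p.1 1 * directSum fun b => (p.2 b : Equiv.Perm (Fin (2 ^ n))) := rfl

theorem card_butterflyGroup (n : ℕ) : Nat.card (butterflyGroup n) = 2 ^ (2 ^ n - 1) := by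
  induction n with
  | zero => simp [butterflyGroup]
  | succ n ih =>
    rw [← Nat.card_congr (butterflyEquiv n), Nat.card_prod, Nat.card_fun, ih]
    simp only [Nat.card_eq_fintype_card, Fintype.card_perm, Fintype.card_fin, Nat.factorial_two]
    rw [← pow_mul, ← pow_succ']
    congr 1
    -- Subtraction is truncated, so `(2 ^ n - 1) * 2 + 1 = 2 ^ (n + 1) - 1` needs `1 ≤ 2 ^ n`.
    have := Nat.one_le_two_pow (n := n)
    rw [pow_succ]
    omega

/-- Legendre: `v₂((2m)!) = v₂(m!) + m`, applied with `m = 2 ^ n`. -/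
theorem factorization_two_factorial_two_pow (n : ℕ) :
    (Nat.factorial (2 ^ n)).factorization 2 = 2 ^ n - 1 := by
  rw [Nat.factorization_def _ Nat.prime_two]
  induction n with
  | zero => simp
  | succ n ih =>
    have := Nat.one_le_two_pow (n := n)
    rw [pow_succ', padicValNat_factorial_mul, ih]
    omega

theorem exists_sylow_eq_butterflyGroup (n : ℕ) :
    ∃ P : Sylow 2 (Equiv.Perm (Fin (2 ^ n))),
      (P : Subgroup (Equiv.Perm (Fin (2 ^ n)))) = butterflyGroup n := by
  refine ⟨Sylow.ofCard (butterflyGroup n) ?_, rfl⟩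
  rw [card_butterflyGroup, Nat.card_eq_fintype_card, Fintype.card_perm, Fintype.card_fin,
    factorization_two_factorial_two_pow]

/-! ### Averages over the butterfly group -/

noncomputable instance (n : ℕ) : Fintype (butterflyGroup n) := Fintype.ofFinite _

/-- The mean of `g (C σ)` for `σ` uniformly distributed on `B_{2^n}`. -/
noncomputable def cycleMean {E : Type*} [AddCommGroup E] [Module ℝ E] (n : ℕ) (g : ℕ → E) : E :=
  (Nat.card (butterflyGroup n) : ℝ)⁻¹ •
    ∑ σ : butterflyGroup n, g (numCycles (σ : Equiv.Perm (Fin (2 ^ n))))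

theorem card_butterflyGroup_succ (n : ℕ) :
    Nat.card (butterflyGroup (n + 1)) =
      2 * (Nat.card (butterflyGroup n) * Nat.card (butterflyGroup n)) := by
  rw [← Nat.card_congr (butterflyEquiv n), Nat.card_prod, Nat.card_fun]
  simp [Fintype.card_perm, Nat.factorial_two, sq]

theorem sum_butterflyGroup_succ {E : Type*} [AddCommGroup E] (n : ℕ) (g : ℕ → E) :
    ∑ σ : butterflyGroup (n + 1), g (numCycles (σ : Equiv.Perm (Fin (2 ^ (n + 1))))) =
      (∑ σ : butterflyGroup n, ∑ ρ : butterflyGroup n,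
        g (numCycles (σ : Equiv.Perm (Fin (2 ^ n))) + numCycles (ρ : Equiv.Perm (Fin (2 ^ n))))) +
      Nat.card (butterflyGroup n) •
        ∑ σ : butterflyGroup n, g (numCycles (σ : Equiv.Perm (Fin (2 ^ n)))) := by
  have hτ : (Finset.univ : Finset (Equiv.Perm (Fin 2))) = {1, Equiv.swap 0 1} := by decide
  have hne : (1 : Equiv.Perm (Fin 2)) ≠ Equiv.swap 0 1 := by decide
  rw [← (butterflyEquiv n).sum_comp, Fintype.sum_prod_type, hτ, Finset.sum_pair hne]
  congr 1
  · rw [← (finTwoArrowEquiv (butterflyGroup n)).symm.sum_comp, Fintype.sum_prod_type]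
    refine Finset.sum_congr rfl fun σ _ => Finset.sum_congr rfl fun ρ _ => ?_
    rw [butterflyEquiv_apply, kronecker_one_one, one_mul, numCycles_directSum]
    rfl
  · rw [← (finTwoArrowEquiv (butterflyGroup n)).symm.sum_comp, Fintype.sum_prod_type]
    have h : ∀ σ : butterflyGroup n, ∑ ρ : butterflyGroup n,
        g (numCycles (butterflyEquiv n (Equiv.swap 0 1,
          (finTwoArrowEquiv (butterflyGroup n)).symm (σ, ρ))).1) =
        ∑ ρ : butterflyGroup n, g (numCycles (ρ : Equiv.Perm (Fin (2 ^ n)))) := fun σ => by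
      -- Right translation by `σ` is a bijection of the group, so for fixed `σ` the product runs
      -- over the whole group once.
      refine Fintype.sum_equiv (Equiv.mulRight σ) _ _ fun ρ => ?_
      rw [butterflyEquiv_apply, numCycles_kronecker_swap_mul_directSum]
      rfl
    rw [Finset.sum_congr rfl fun σ _ => h σ, Finset.sum_const, Finset.card_univ,
      ← Nat.card_eq_fintype_card]

section

variable {E : Type*} [AddCommGroup E] [Module ℝ E]

theorem cycleMean_zero (g : ℕ → E) : cycleMean 0 g = g 1 := by
  have h1 : Nat.card (butterflyGroup 0) = 1 := by simp [butterflyGroup]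
  have : Subsingleton (Fin (2 ^ 0)) := by rw [pow_zero]; infer_instance
  have h2 : ∀ σ : Equiv.Perm (Fin (2 ^ 0)), numCycles σ = 1 := fun σ => by
    refine Nat.card_eq_one_iff_unique.2 ⟨⟨fun x y => ?_⟩, ⟨Quotient.mk'' 0⟩⟩
    induction x using Quotient.inductionOn' with | _ x => ?_
    induction y using Quotient.inductionOn' with | _ y => ?_
    exact congrArg _ (Subsingleton.elim x y)
  rw [cycleMean, h1]
  simp [h2, ← Nat.card_eq_fintype_card]

/-- The branching step. Values in a general `E` let one recursion serve both real moments and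
complex characteristic functions. -/
theorem cycleMean_succ (n : ℕ) (g : ℕ → E) :
    cycleMean (n + 1) g = (2⁻¹ : ℝ) • cycleMean n g +
      (2⁻¹ : ℝ) • cycleMean n (fun i => cycleMean n fun j => g (i + j)) := by
  have hc : (Nat.card (butterflyGroup n) : ℝ) ≠ 0 := by
    exact_mod_cast Nat.card_pos.ne'
  simp only [cycleMean, card_butterflyGroup_succ, sum_butterflyGroup_succ, ← Finset.smul_sum,
    smul_smul, ← Nat.cast_smul_eq_nsmul ℝ, smul_add]
  rw [add_comm]
  congr 2
  · push_cast
    field_simp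
  · push_cast
    field_simp

end

section

variable {E : Type*} [AddCommGroup E] [Module ℝ E]

theorem cycleMean_finsetSum {ι : Type*} (s : Finset ι) (n : ℕ) (g : ι → ℕ → E) :
    cycleMean n (fun i => ∑ k ∈ s, g k i) = ∑ k ∈ s, cycleMean n (g k) := by
  simp only [cycleMean]
  rw [Finset.sum_comm, Finset.smul_sum]

theorem cycleMean_const (n : ℕ) (c : E) : cycleMean n (fun _ => c) = c := by
  have hc : (Nat.card (butterflyGroup n) : ℝ) ≠ 0 := by
    exact_mod_cast Nat.card_pos.ne'
  rw [cycleMean, Finset.sum_const, Finset.card_univ, ← Nat.card_eq_fintype_card,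
    ← Nat.cast_smul_eq_nsmul ℝ, smul_smul, inv_mul_cancel₀ hc, one_smul]

end

theorem cycleMean_const_mul {A : Type*} [Ring A] [Algebra ℝ A] (n : ℕ) (c : A) (g : ℕ → A) :
    cycleMean n (fun i => c * g i) = c * cycleMean n g := by
  simp only [cycleMean, ← Finset.mul_sum, mul_smul_comm]

theorem cycleMean_mul_const {A : Type*} [Ring A] [Algebra ℝ A] (n : ℕ) (c : A) (g : ℕ → A) :
    cycleMean n (fun i => g i * c) = cycleMean n g * c := by
  simp only [cycleMean, ← Finset.sum_mul, smul_mul_assoc]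

theorem cycleMean_mul_cycleMean {A : Type*} [Ring A] [Algebra ℝ A] (n : ℕ) (g h : ℕ → A) :
    cycleMean n (fun i => cycleMean n fun j => g i * h j) = cycleMean n g * cycleMean n h := by
  simp only [cycleMean_const_mul, cycleMean_mul_const]

theorem cycleMean_nonneg (n : ℕ) {g : ℕ → ℝ} (hg : ∀ i, 0 ≤ g i) : 0 ≤ cycleMean n g :=
  smul_nonneg (by positivity) (Finset.sum_nonneg fun _ _ => hg _)

/-! ### Laws and characteristic functions -/

instance isProbabilityMeasure_uniformOn_butterflyGroup (n : ℕ) :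
    IsProbabilityMeasure
      (uniformOn (butterflyGroup n : Set (Equiv.Perm (Fin (2 ^ n))))) :=
  isProbabilityMeasure_uniformOn (Set.toFinite _) ⟨1, one_mem _⟩

theorem integral_uniformOn_butterflyGroup {E : Type*} [NormedAddCommGroup E] [NormedSpace ℝ E]
    [CompleteSpace E]
    (n : ℕ) (g : ℕ → E) :
    ∫ σ, g (numCycles σ) ∂uniformOn (butterflyGroup n : Set (Equiv.Perm (Fin (2 ^ n)))) =
      cycleMean n g := by
  have hs : MeasurableSet (butterflyGroup n : Set (Equiv.Perm (Fin (2 ^ n)))) := trivial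
  rw [uniformOn, ProbabilityTheory.cond, integral_smul_measure, cycleMean]
  congr 1
  · rw [Measure.count_apply_finite _ (Set.toFinite _), ENNReal.toReal_inv, ENNReal.toReal_natCast,
      ← Set.ncard_eq_toFinset_card _, ← Nat.card_coe_set_eq]
    rfl
  · classical
    rw [← integral_indicator hs, integral_count]
    simp only [Set.indicator_apply, ← Finset.sum_filter]
    exact Finset.sum_subtype _ (by simp) _

/-- The law of the normalized number of cycles `C(σ) (2/3)^n`, for `σ` uniformly distributed
on `B_{2^n}`. -/
noncomputable def cycleLaw (n : ℕ) : Measure ℝ :=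
  (uniformOn (butterflyGroup n : Set (Equiv.Perm (Fin (2 ^ n))))).map
    fun σ => (numCycles σ : ℝ) * (2 / 3 : ℝ) ^ n

theorem measurable_normalized_numCycles (n : ℕ) :
    Measurable fun σ : Equiv.Perm (Fin (2 ^ n)) => (numCycles σ : ℝ) * (2 / 3 : ℝ) ^ n :=
  fun _ _ => trivial

instance (n : ℕ) : IsProbabilityMeasure (cycleLaw n) :=
  Measure.isProbabilityMeasure_map (measurable_normalized_numCycles n).aemeasurable

theorem integral_cycleLaw {E : Type*} [NormedAddCommGroup E] [NormedSpace ℝ E]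
    [CompleteSpace E] (n : ℕ) {f : ℝ → E} (hf : Continuous f) :
    ∫ x, f x ∂cycleLaw n = cycleMean n fun i => f (i * (2 / 3 : ℝ) ^ n) := by
  rw [cycleLaw, integral_map (measurable_normalized_numCycles n).aemeasurable
    hf.aestronglyMeasurable]
  exact integral_uniformOn_butterflyGroup n fun i => f (i * (2 / 3 : ℝ) ^ n)

theorem integrable_cycleLaw (n : ℕ) {f : ℝ → ℝ} (hf : Continuous f) :
    Integrable f (cycleLaw n) := by
  rw [cycleLaw, integrable_map_measure hf.aestronglyMeasurable
    (measurable_normalized_numCycles n).aemeasurable]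
  exact Integrable.of_finite

theorem cycleLaw_Iio_zero (n : ℕ) : cycleLaw n (Set.Iio 0) = 0 := by
  rw [cycleLaw, Measure.map_apply (measurable_normalized_numCycles n) measurableSet_Iio]
  convert measure_empty (μ := uniformOn (butterflyGroup n : Set (Equiv.Perm (Fin (2 ^ n)))))
  ext σ
  simp only [Set.mem_preimage, Set.mem_Iio, Set.mem_empty_iff_false, iff_false, not_lt]
  positivity

theorem charFun_cycleLaw (n : ℕ) (t : ℝ) :
    charFun (cycleLaw n) t =
      cycleMean n fun i => Complex.exp (t * ((i * (2 / 3 : ℝ) ^ n : ℝ) : ℂ) * Complex.I) := by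
  rw [charFun_apply_real, integral_cycleLaw n (by fun_prop)]

theorem charFun_cycleLaw_zero (t : ℝ) :
    charFun (cycleLaw 0) t = Complex.exp (t * Complex.I) := by
  simp [charFun_cycleLaw, cycleMean_zero]

theorem charFun_cycleLaw_succ (n : ℕ) (t : ℝ) :
    charFun (cycleLaw (n + 1)) t = 2⁻¹ * charFun (cycleLaw n) (2 / 3 * t) +
      2⁻¹ * (charFun (cycleLaw n) (2 / 3 * t) * charFun (cycleLaw n) (2 / 3 * t)) := by
  simp only [charFun_cycleLaw, cycleMean_succ, ← cycleMean_mul_cycleMean, ← Complex.exp_add]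
  have h : ((2⁻¹ : ℝ) : ℂ) = 2⁻¹ := by push_cast; rfl
  simp only [Complex.real_smul, h]
  congr 3
  · ext i
    congr 1
    push_cast
    ring
  · ext i
    congr 1
    ext j
    congr 1
    push_cast
    ring

/-- The bound is quadratic in `t` because all the laws have mean 1; a linear bound would gain only
`(2/3)·(3/2) = 1` per step. -/
theorem norm_charFun_cycleLaw_succ_sub_le (n : ℕ) (t : ℝ) :
    ‖charFun (cycleLaw n) t - charFun (cycleLaw (n + 1)) t‖ ≤ t ^ 2 / 18 * (2 / 3) ^ n := by
  induction n generalizing t with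
  | zero =>
    rw [charFun_cycleLaw_succ, charFun_cycleLaw_zero, charFun_cycleLaw_zero, ← Complex.exp_add]
    -- With `u = t/3`: `e^{3iu} - (e^{2iu} + e^{4iu})/2 = e^{3iu}(1 - cos u)`, and `1 - cos u ≤ u²/2
    -- = t²/18`.
    have h : Complex.exp (t * Complex.I) - (2⁻¹ * Complex.exp ((2 / 3 * t : ℝ) * Complex.I) +
        2⁻¹ * Complex.exp ((2 / 3 * t : ℝ) * Complex.I + (2 / 3 * t : ℝ) * Complex.I)) =
        Complex.exp (t * Complex.I) * ((1 - Real.cos (t / 3) : ℝ) : ℂ) := by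
      push_cast
      rw [Complex.cos, mul_sub, mul_one, mul_div_assoc', mul_add, ← Complex.exp_add,
        ← Complex.exp_add]
      have h1 : (t : ℂ) * Complex.I + t / 3 * Complex.I =
        2 / 3 * t * Complex.I + 2 / 3 * t * Complex.I := by ring
      have h2 : (t : ℂ) * Complex.I + -(t / 3) * Complex.I = 2 / 3 * t * Complex.I := by ring
      rw [h1, h2]
      ring
    rw [h, norm_mul, Complex.norm_exp_ofReal_mul_I, one_mul, Complex.norm_real, Real.norm_eq_abs,
      abs_of_nonneg (by linarith [Real.cos_le_one (t / 3)])]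
    have := Real.one_sub_sq_div_two_le_cos (x := t / 3)
    linarith
  | succ n ih =>
    rw [charFun_cycleLaw_succ, charFun_cycleLaw_succ (n + 1)]
    set a := charFun (cycleLaw n) (2 / 3 * t) with ha
    set b := charFun (cycleLaw (n + 1)) (2 / 3 * t) with hb
    have h1 : ‖a‖ ≤ 1 := norm_charFun_le_one _
    have h2 : ‖b‖ ≤ 1 := norm_charFun_le_one _
    have h3 : 2⁻¹ * a + 2⁻¹ * (a * a) - (2⁻¹ * b + 2⁻¹ * (b * b)) =
      (a - b) * (2⁻¹ * (1 + a + b)) := by ring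
    have h4 : ‖2⁻¹ * (1 + a + b)‖ ≤ 3 / 2 := by
      rw [norm_mul, norm_inv, Complex.norm_ofNat]
      have := norm_add₃_le (a := 1) (b := a) (c := b)
      rw [norm_one] at this
      linarith
    rw [h3, norm_mul]
    calc ‖a - b‖ * ‖2⁻¹ * (1 + a + b)‖
        ≤ ((2 / 3 * t) ^ 2 / 18 * (2 / 3) ^ n) * (3 / 2) := by
          gcongr
          exact ih _
      _ = t ^ 2 / 18 * (2 / 3) ^ (n + 1) := by ring

/-! ### Existence of the limit law -/

/-- A form of **Lévy's continuity theorem**: if the characteristic functions converge pointwise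
to a function that is continuous at `0`, then the probability measures converge weakly. -/
theorem _root_.MeasureTheory.ProbabilityMeasure.exists_tendsto_of_tendsto_charFun {E : Type*}
    [NormedAddCommGroup E] [InnerProductSpace ℝ E] [FiniteDimensional ℝ E] [MeasurableSpace E]
    [BorelSpace E] {μ : ℕ → ProbabilityMeasure E} {φ : E → ℂ} (hφ : ContinuousAt φ 0)
    (h : ∀ t, Tendsto (fun n => charFun (μ n) t) atTop (𝓝 (φ t))) :
    ∃ ν : ProbabilityMeasure E, Tendsto μ atTop (𝓝 ν) := by
  have ht := isTightMeasureSet_of_tendsto_charFun hφ h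
  have hS : IsTightMeasureSet {((ρ : ProbabilityMeasure E) : Measure E) | ρ ∈ Set.range μ} := by
    convert ht using 1
    ext ρ
    simp
  -- By Prokhorov the closure of the range is compact, so a free ultrafilter yields a limit `ν`; its
  -- characteristic function must be `φ`, which upgrades to convergence of the whole sequence.
  have hμ : ((hyperfilter ℕ).map μ : Filter (ProbabilityMeasure E)) ≤
      𝓟 (closure (Set.range μ)) := by
    rw [le_principal_iff]
    exact Filter.mem_map.2 (univ_mem' fun n => subset_closure ⟨n, rfl⟩)
  obtain ⟨ν, -, hν⟩ := (isCompact_closure_of_isTightMeasureSet hS).ultrafilter_le_nhds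
    ((hyperfilter ℕ).map μ) hμ
  refine ⟨ν, ProbabilityMeasure.tendsto_of_tendsto_charFun fun t => ?_⟩
  have h1 : Tendsto (fun n => charFun (μ n) t) (hyperfilter ℕ) (𝓝 (charFun ν t)) := by
    have h2 : Tendsto μ (hyperfilter ℕ) (𝓝 ν) := hν
    rw [ProbabilityMeasure.tendsto_iff_forall_integral_rclike_tendsto ℂ] at h2
    simp_rw [charFun_eq_integral_innerProbChar]
    exact h2 (BoundedContinuousFunction.innerProbChar t)
  rw [tendsto_nhds_unique h1 ((h t).mono_left (Nat.hyperfilter_le_atTop))]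
  exact h t

/-- The law of the normalized number of cycles, as a point of the space of probability
measures. -/
noncomputable def cycleProb (n : ℕ) : ProbabilityMeasure ℝ := ⟨cycleLaw n, inferInstance⟩

theorem exists_tendsto_cycleProb :
    ∃ ν : ProbabilityMeasure ℝ, Tendsto cycleProb atTop (𝓝 ν) := by
  have h1 : ∀ t n, dist (charFun (cycleLaw n) t) (charFun (cycleLaw (n + 1)) t) ≤
      t ^ 2 / 18 * (2 / 3) ^ n := fun t n => by
    rw [dist_eq_norm]
    exact norm_charFun_cycleLaw_succ_sub_le n t
  have h2 : ∀ t, ∃ z, Tendsto (fun n => charFun (cycleLaw n) t) atTop (𝓝 z) := fun t =>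
    cauchySeq_tendsto_of_complete
      (cauchySeq_of_le_geometric (2 / 3) (t ^ 2 / 18) (by norm_num) (h1 t))
  choose φ hφ using h2
  refine ProbabilityMeasure.exists_tendsto_of_tendsto_charFun (φ := φ) ?_ hφ
  -- Summing the geometric series bounds the distance by `t²/6`, which vanishes at `0` and gives
  -- continuity of `φ` there.
  have h3 : ∀ t, dist (charFun (cycleLaw 0) t) (φ t) ≤ t ^ 2 / 18 / (1 - 2 / 3) := fun t =>
    dist_le_of_le_geometric_of_tendsto₀ (2 / 3) (t ^ 2 / 18) (by norm_num) (h1 t) (hφ t)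
  have h4 : φ 0 = charFun (cycleLaw 0) 0 := by
    have := h3 0
    rw [← dist_le_zero, dist_comm]
    simpa using this
  have h5 : Tendsto (charFun (cycleLaw 0)) (𝓝 0) (𝓝 (φ 0)) := by
    rw [h4]
    exact continuous_charFun.tendsto 0
  refine h5.congr_dist (squeeze_zero (fun _ => dist_nonneg) h3 ?_)
  have h6 : Continuous fun t : ℝ => t ^ 2 / 18 / (1 - 2 / 3) := by fun_prop
  simpa using h6.tendsto 0

/-! ### Moments -/

/-- The `k`-th moment of the normalized number of cycles. -/
noncomputable def cycleMoment (n k : ℕ) : ℝ :=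
  cycleMean n fun i => ((i : ℝ) * (2 / 3 : ℝ) ^ n) ^ k

theorem cycleMoment_zero_right (n : ℕ) : cycleMoment n 0 = 1 := by
  simp only [cycleMoment, pow_zero, cycleMean_const]

theorem cycleMoment_nonneg (n k : ℕ) : 0 ≤ cycleMoment n k :=
  cycleMean_nonneg n fun i => by positivity

theorem cycleMoment_succ (n k : ℕ) :
    cycleMoment (n + 1) k = (2 / 3) ^ k * (2⁻¹ * cycleMoment n k +
      2⁻¹ * ∑ j ∈ Finset.range (k + 1),
        (k.choose j : ℝ) * cycleMoment n j * cycleMoment n (k - j)) := by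
  have h1 : cycleMean n (fun i => ((i : ℝ) * (2 / 3 : ℝ) ^ (n + 1)) ^ k) =
      (2 / 3) ^ k * cycleMoment n k := by
    rw [cycleMoment, ← cycleMean_const_mul]
    congr 1
    ext i
    rw [← mul_pow]
    ring
  have h2 : ∀ i j : ℕ, (((i + j : ℕ) : ℝ) * (2 / 3 : ℝ) ^ (n + 1)) ^ k =
      (2 / 3) ^ k * ∑ l ∈ Finset.range (k + 1), (k.choose l : ℝ) *
        (((i : ℝ) * (2 / 3 : ℝ) ^ n) ^ l * ((j : ℝ) * (2 / 3 : ℝ) ^ n) ^ (k - l)) := fun i j => by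
    have : ((i + j : ℕ) : ℝ) * (2 / 3 : ℝ) ^ (n + 1) =
      2 / 3 * ((i : ℝ) * (2 / 3 : ℝ) ^ n + (j : ℝ) * (2 / 3 : ℝ) ^ n) := by push_cast; ring
    rw [this, mul_pow, add_pow]
    congr 1
    exact Finset.sum_congr rfl fun l _ => by ring
  have h3 : ∀ l, cycleMean n (fun i => ((i : ℝ) * (2 / 3 : ℝ) ^ n) ^ l) = cycleMoment n l :=
    fun _ => rfl
  rw [cycleMoment, cycleMean_succ, h1]
  simp only [h2, cycleMean_const_mul, cycleMean_finsetSum, smul_eq_mul, cycleMean_mul_const, h3,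
    mul_assoc]
  ring

theorem cycleMoment_one_right (n : ℕ) : cycleMoment n 1 = 1 := by
  induction n with
  | zero => simp [cycleMoment, cycleMean_zero]
  | succ n ih =>
    rw [cycleMoment_succ, Finset.sum_range_succ, Finset.sum_range_one]
    simp only [ih, cycleMoment_zero_right, Nat.choose_zero_right, Nat.choose_one_right, Nat.sub_zero,
      Nat.sub_self]
    norm_num

/-- The terms `j = 0` and `j = k` join the single-copy term: the total coefficient `3/2 · (2/3)^k =
(2/3)^(k-1)` is a contraction for `k ≥ 2`. -/
theorem cycleMoment_succ_of_two_le (n : ℕ) {k : ℕ} (hk : 2 ≤ k) :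
    cycleMoment (n + 1) k = (2 / 3) ^ (k - 1) * cycleMoment n k +
      (2 / 3) ^ k * (2⁻¹ * ∑ j ∈ Finset.Ioo 0 k,
        (k.choose j : ℝ) * cycleMoment n j * cycleMoment n (k - j)) := by
  have hs : Finset.range (k + 1) = insert 0 (insert k (Finset.Ioo 0 k)) := by
    ext j
    simp only [Finset.mem_range, Finset.mem_insert, Finset.mem_Ioo]
    omega
  rw [cycleMoment_succ, hs, Finset.sum_insert (by simp; omega), Finset.sum_insert (by simp)]
  simp only [cycleMoment_zero_right, Nat.choose_zero_right, Nat.choose_self, Nat.sub_zero,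
    Nat.sub_self]
  obtain ⟨k, rfl⟩ : ∃ l, k = l + 1 := ⟨k - 1, by omega⟩
  rw [Nat.add_sub_cancel, pow_succ]
  push_cast
  ring

theorem _root_.exists_forall_le_of_succ_le_mul_add {a : ℕ → ℝ} {q c : ℝ} (hq : 0 ≤ q) (hq' : q < 1)
    (h : ∀ n, a (n + 1) ≤ q * a n + c) : ∃ B, ∀ n, a n ≤ B := by
  -- `c / (1 - q)` is the fixed point of `x ↦ q * x + c`.
  refine ⟨max (a 0) (c / (1 - q)), fun n => ?_⟩
  induction n with
  | zero => exact le_max_left _ _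
  | succ n ih =>
    set B := max (a 0) (c / (1 - q))
    have h1 : c ≤ B * (1 - q) := (div_le_iff₀ (by linarith)).1 (le_max_right _ _)
    nlinarith [h n, mul_le_mul_of_nonneg_left ih hq]

theorem exists_cycleMoment_le (k : ℕ) : ∃ B, ∀ n, cycleMoment n k ≤ B := by
  induction k using Nat.strong_induction_on with
  | _ k ih =>
    obtain rfl | rfl | hk : k = 0 ∨ k = 1 ∨ 2 ≤ k := by omega
    · exact ⟨1, fun n => (cycleMoment_zero_right n).le⟩
    · exact ⟨1, fun n => (cycleMoment_one_right n).le⟩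
    choose! B hB using ih
    have hq : ((2 : ℝ) / 3) ^ (k - 1) < 1 := pow_lt_one₀ (by norm_num) (by norm_num) (by omega)
    refine exists_forall_le_of_succ_le_mul_add (by positivity) hq (c :=
      (2 / 3) ^ k * (2⁻¹ * ∑ j ∈ Finset.Ioo 0 k, (k.choose j : ℝ) * B j * B (k - j))) fun n => ?_
    rw [cycleMoment_succ_of_two_le n hk]
    gcongr with j hj
    · exact cycleMoment_nonneg _ _
    · rw [Finset.mem_Ioo] at hj
      exact mul_nonneg (by positivity) ((cycleMoment_nonneg n j).trans (hB j hj.2 n))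
    · exact hB j (Finset.mem_Ioo.1 hj).2 n
    · rw [Finset.mem_Ioo] at hj
      exact hB (k - j) (by omega) n

/-- If `μ n` converges weakly to `ν` and the second moments of a nonnegative continuous function
`f` under `μ n` are bounded, then the means of `f` converge to its mean under `ν`. -/
theorem _root_.MeasureTheory.ProbabilityMeasure.tendsto_integral_of_integral_sq_le {X : Type*}
    [TopologicalSpace X] [MeasurableSpace X] [OpensMeasurableSpace X] [HasOuterApproxClosed X]
    {μ : ℕ → ProbabilityMeasure X} {ν : ProbabilityMeasure X} (hμ : Tendsto μ atTop (𝓝 ν))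
    {f : X → ℝ} (hf : Continuous f) (hf0 : 0 ≤ f) {C : ℝ}
    (hi : ∀ n, Integrable (fun x => f x ^ 2) (μ n : Measure X))
    (hC : ∀ n, ∫ x, f x ^ 2 ∂(μ n : Measure X) ≤ C) :
    Integrable f (ν : Measure X) ∧
      Tendsto (fun n => ∫ x, f x ∂(μ n : Measure X)) atTop (𝓝 (∫ x, f x ∂(ν : Measure X))) := by
  have hC0 : 0 ≤ C := (integral_nonneg fun x => sq_nonneg _).trans (hC 0)
  have hf2 : Continuous fun x => f x ^ 2 := hf.pow 2
  -- Fatou's inequality along weak convergence, from the portmanteau bound on open sets.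
  have hle : ∫⁻ x, ENNReal.ofReal (f x ^ 2) ∂(ν : Measure X) ≤ ENNReal.ofReal C := by
    refine (lintegral_le_liminf_lintegral_of_forall_isOpen_measure_le_liminf_measure
      (μs := fun n => (μ n : Measure X)) hf2 (fun x => sq_nonneg _)
      fun G hG => ProbabilityMeasure.le_liminf_measure_open_of_tendsto hμ hG).trans ?_
    refine liminf_le_of_le (by isBoundedDefault) fun b hb => ?_
    obtain ⟨n, hn⟩ := hb.exists
    refine hn.trans ?_
    rw [← ofReal_integral_eq_lintegral_ofReal (hi n) (ae_of_all _ fun x => sq_nonneg _)]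
    exact ENNReal.ofReal_le_ofReal (hC n)
  have hνi : Integrable (fun x => f x ^ 2) (ν : Measure X) := by
    refine ⟨hf2.aestronglyMeasurable, ?_⟩
    rw [hasFiniteIntegral_iff_ofReal (ae_of_all _ fun x => sq_nonneg _)]
    exact hle.trans_lt ENNReal.ofReal_lt_top
  have hνC : ∫ x, f x ^ 2 ∂(ν : Measure X) ≤ C := by
    rw [← ofReal_integral_eq_lintegral_ofReal hνi (ae_of_all _ fun x => sq_nonneg _)] at hle
    exact (ENNReal.ofReal_le_ofReal_iff hC0).1 hle
  have hint : ∀ ρ : ProbabilityMeasure X, Integrable (fun x => f x ^ 2) (ρ : Measure X) →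
      Integrable f (ρ : Measure X) := fun ρ h =>
    ((memLp_two_iff_integrable_sq hf.aestronglyMeasurable).2 h).integrable one_le_two
  have hfm : ∀ R : ℝ, Continuous fun x => min (f x) R := fun R => hf.min continuous_const
  have hmi : ∀ (ρ : ProbabilityMeasure X) (R : ℝ), 0 < R →
      Integrable (fun x => min (f x) R) (ρ : Measure X) := fun ρ R hR =>
    Integrable.of_bound (hfm R).aestronglyMeasurable R (ae_of_all _ fun x => by
      rw [Real.norm_eq_abs, abs_of_nonneg (le_min (hf0 x) hR.le)]
      exact min_le_right _ _)
  -- Truncation error, uniform in the measure: `f - min f R ≤ f² / R` pointwise.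
  have happrox : ∀ (ρ : ProbabilityMeasure X) (R : ℝ), 0 < R →
      Integrable (fun x => f x ^ 2) (ρ : Measure X) → ∫ x, f x ^ 2 ∂(ρ : Measure X) ≤ C →
      |∫ x, f x ∂(ρ : Measure X) - ∫ x, min (f x) R ∂(ρ : Measure X)| ≤ C / R := by
    intro ρ R hR h1 h2
    rw [← integral_sub (hint ρ h1) (hmi ρ R hR), abs_of_nonneg
      (integral_nonneg fun x => sub_nonneg.2 (min_le_left _ _))]
    calc ∫ x, (f x - min (f x) R) ∂(ρ : Measure X)
        ≤ ∫ x, f x ^ 2 / R ∂(ρ : Measure X) := by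
          refine integral_mono ((hint ρ h1).sub (hmi ρ R hR)) (h1.div_const R) fun x => ?_
          simp only
          have hx := hf0 x
          simp only [Pi.zero_apply] at hx
          rw [le_div_iff₀ hR]
          rcases le_total (f x) R with h | h
          · rw [min_eq_left h, sub_self, zero_mul]
            positivity
          · rw [min_eq_right h]
            nlinarith
      _ ≤ C / R := by
          rw [integral_div]
          gcongr
  refine ⟨hint ν hνi, ?_⟩
  rw [Metric.tendsto_atTop]
  intro ε hε
  -- `C + 1` rather than `C` keeps `R` positive when `C = 0`.
  set R : ℝ := (C + 1) / (ε / 3) with hR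
  have hR0 : 0 < R := by positivity
  have hCR : C / R ≤ ε / 3 := by
    rw [div_le_iff₀ hR0, hR, mul_div_cancel₀ _ (by positivity)]
    linarith
  let g : BoundedContinuousFunction X ℝ := BoundedContinuousFunction.ofNormedAddCommGroup
    (fun x => min (f x) R) (hfm R) R fun x => by
      rw [Real.norm_eq_abs, abs_of_nonneg (le_min (hf0 x) hR0.le)]
      exact min_le_right _ _
  have hg := ProbabilityMeasure.tendsto_iff_forall_integral_tendsto.1 hμ g
  obtain ⟨N, hN⟩ := Metric.tendsto_atTop.1 hg (ε / 3) (by positivity)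
  refine ⟨N, fun n hn => ?_⟩
  have h1 : |∫ x, min (f x) R ∂(μ n : Measure X) - ∫ x, min (f x) R ∂(ν : Measure X)| < ε / 3 :=
    hN n hn
  have h2 := (happrox (μ n) R hR0 (hi n) (hC n)).trans hCR
  have h3 := (happrox ν R hR0 hνi hνC).trans hCR
  rw [Real.dist_eq]
  rw [abs_le] at h2 h3
  rw [abs_lt] at h1 ⊢
  constructor <;> linarith

/-! ### Positivity and moments of the limit law -/

open scoped ENNReal

variable {ν : ProbabilityMeasure ℝ}

theorem measure_Iio_zero_of_tendsto_cycleProb (hν : Tendsto cycleProb atTop (𝓝 ν)) :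
    (ν : Measure ℝ) (Set.Iio 0) = 0 := by
  have h := ProbabilityMeasure.le_liminf_measure_open_of_tendsto hν (isOpen_Iio (a := (0 : ℝ)))
  have h' : ∀ n, (cycleProb n : Measure ℝ) (Set.Iio 0) = 0 := cycleLaw_Iio_zero
  simpa [h'] using h

theorem ae_nonneg_of_measure_Iio_zero {μ : Measure ℝ} (h : μ (Set.Iio 0) = 0) :
    ∀ᵐ x ∂μ, 0 ≤ x := by
  rw [ae_iff]
  simpa only [not_le] using! h

theorem integral_abs_pow_cycleLaw (n k : ℕ) :
    ∫ x, |x| ^ k ∂cycleLaw n = cycleMoment n k := by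
  rw [integral_cycleLaw n (by fun_prop), cycleMoment]
  congr 1
  ext i
  rw [abs_of_nonneg (by positivity)]

theorem moments_of_tendsto_cycleProb (hν : Tendsto cycleProb atTop (𝓝 ν)) (k : ℕ) :
    Integrable (fun x : ℝ => x ^ k) (ν : Measure ℝ) ∧
      Tendsto (fun n => cycleMoment n k) atTop (𝓝 (∫ x, x ^ k ∂(ν : Measure ℝ))) := by
  -- Uniform integrability of `|x| ^ k` comes from its second moment, hence the order `k * 2`.
  obtain ⟨C, hC⟩ := exists_cycleMoment_le (k * 2)
  obtain ⟨h1, h2⟩ := ProbabilityMeasure.tendsto_integral_of_integral_sq_le hν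
    (f := fun x : ℝ => |x| ^ k) (by fun_prop) (fun x => by simp only [Pi.zero_apply]; positivity)
    (C := C) (fun n => integrable_cycleLaw n (by fun_prop)) (fun n => by
      simp only [← pow_mul]
      exact (integral_abs_pow_cycleLaw n (k * 2)).trans_le (hC n))
  have h3 : (fun x : ℝ => |x| ^ k) =ᵐ[(ν : Measure ℝ)] fun x => x ^ k := by
    filter_upwards [ae_nonneg_of_measure_Iio_zero (measure_Iio_zero_of_tendsto_cycleProb hν)]
      with x hx
    rw [abs_of_nonneg hx]
  refine ⟨h1.congr h3, ?_⟩
  rw [← integral_congr_ae h3]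
  exact h2.congr fun n => integral_abs_pow_cycleLaw n k

theorem integral_id_of_tendsto_cycleProb (hν : Tendsto cycleProb atTop (𝓝 ν)) :
    ∫ x, x ^ 1 ∂(ν : Measure ℝ) = 1 := by
  refine tendsto_nhds_unique (moments_of_tendsto_cycleProb hν 1).2 ?_
  simp only [cycleMoment_one_right, tendsto_const_nhds]

theorem integral_pow_of_tendsto_cycleProb (hν : Tendsto cycleProb atTop (𝓝 ν)) {k : ℕ}
    (hk : 2 ≤ k) :
    ∫ x, x ^ k ∂(ν : Measure ℝ) = ((3 / 2 : ℝ) - 1) / ((3 / 2 : ℝ) ^ k - 3 / 2) *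
      ∑ j ∈ Finset.Ioo 0 k, (k.choose j : ℝ) * (∫ x, x ^ j ∂(ν : Measure ℝ)) *
        ∫ x, x ^ (k - j) ∂(ν : Measure ℝ) := by
  have h1 := ((moments_of_tendsto_cycleProb hν k).2.const_mul ((2 / 3 : ℝ) ^ (k - 1))).add
    (((tendsto_finsetSum (Finset.Ioo 0 k) fun j _ =>
      ((moments_of_tendsto_cycleProb hν j).2.const_mul (k.choose j : ℝ)).mul
        (moments_of_tendsto_cycleProb hν (k - j)).2).const_mul (2⁻¹ : ℝ)).const_mul
          ((2 / 3 : ℝ) ^ k))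
  have h2 := ((moments_of_tendsto_cycleProb hν k).2.comp (tendsto_add_atTop_nat 1)).congr
    fun n => cycleMoment_succ_of_two_le n hk
  have h3 := tendsto_nhds_unique h2 h1
  set S := ∑ j ∈ Finset.Ioo 0 k, (k.choose j : ℝ) * (∫ x, x ^ j ∂(ν : Measure ℝ)) *
        ∫ x, x ^ (k - j) ∂(ν : Measure ℝ)
  set M := ∫ x, x ^ k ∂(ν : Measure ℝ)
  obtain ⟨k, rfl⟩ : ∃ l, k = l + 1 := ⟨k - 1, by omega⟩
  have h4 : (1 : ℝ) < (3 / 2) ^ k := one_lt_pow₀ (by norm_num) (by omega)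
  have h5 : (3 / 2 : ℝ) ^ (k + 1) - 3 / 2 ≠ 0 := by
    rw [pow_succ]
    linarith
  have h6 : (3 / 2 : ℝ) ^ (k + 1) * (2 / 3) ^ (k + 1) = 1 := by
    rw [← mul_pow]
    norm_num
  have h7 : (3 / 2 : ℝ) ^ (k + 1) * (2 / 3) ^ k = 3 / 2 := by
    rw [pow_succ, mul_right_comm, ← mul_pow]
    norm_num
  rw [div_mul_eq_mul_div, eq_div_iff h5]
  rw [Nat.add_sub_cancel] at h3
  -- The limit equation times `(3/2)^(k+1)`; the factor `1/2` on the sum is `λ - 1`.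
  linear_combination (3 / 2 : ℝ) ^ (k + 1) * h3 + M * h7 + 2⁻¹ * S * h6

/-! ### Fixed point equation and support -/

/-- The distributional fixed point equation `3/2 W = ε₁ W + ε₂ W'` of the limit law, where
`ε₁ = 1` and `ε₂ = 0` or `1` with probability `1/2` each. -/
theorem fixedPoint_of_tendsto_cycleProb (hν : Tendsto cycleProb atTop (𝓝 ν)) :
    (ν : Measure ℝ) = ((2⁻¹ : ℝ≥0∞) • (ν : Measure ℝ) +
      (2⁻¹ : ℝ≥0∞) • ((ν : Measure ℝ) ∗ (ν : Measure ℝ))).map (fun x => 2 / 3 * x) := by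
  have h := ProbabilityMeasure.tendsto_iff_tendsto_charFun.1 hν
  have hfin : ∀ μ : Measure ℝ, IsFiniteMeasure μ → IsFiniteMeasure ((2⁻¹ : ℝ≥0∞) • μ) :=
    fun μ _ => μ.smul_finite (by simp)
  have := hfin (ν : Measure ℝ) inferInstance
  have := hfin ((ν : Measure ℝ) ∗ (ν : Measure ℝ)) inferInstance
  refine Measure.ext_of_charFun (funext fun t => ?_)
  have hsmul : ∀ (μ : Measure ℝ) (s : ℝ), charFun ((2⁻¹ : ℝ≥0∞) • μ) s = 2⁻¹ * charFun μ s := by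
    intro μ s
    rw [charFun_apply_real, integral_smul_measure, ← charFun_apply_real]
    simp
  have hadd : ∀ (μ ρ : Measure ℝ) [IsFiniteMeasure μ] [IsFiniteMeasure ρ] (s : ℝ),
      charFun (μ + ρ) s = charFun μ s + charFun ρ s := by
    intro μ ρ _ _ s
    simp only [charFun_eq_integral_innerProbChar]
    exact integral_add_measure (BoundedContinuousFunction.integrable _ _)
      (BoundedContinuousFunction.integrable _ _)
  rw [charFun_map_mul, hadd, hsmul, hsmul, charFun_conv]
  refine tendsto_nhds_unique ((h t).comp (tendsto_add_atTop_nat 1)) ?_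
  exact ((((h (2 / 3 * t)).const_mul 2⁻¹).add
    (((h (2 / 3 * t)).mul (h (2 / 3 * t))).const_mul 2⁻¹))).congr
      fun n => (charFun_cycleLaw_succ n t).symm

theorem measure_eq_of_tendsto_cycleProb (hν : Tendsto cycleProb atTop (𝓝 ν)) {s : Set ℝ}
    (hs : MeasurableSet s) :
    (ν : Measure ℝ) s = 2⁻¹ * (ν : Measure ℝ) ((fun x => 2 / 3 * x) ⁻¹' s) +
      2⁻¹ * ((ν : Measure ℝ).prod (ν : Measure ℝ))
        ((fun p : ℝ × ℝ => 2 / 3 * (p.1 + p.2)) ⁻¹' s) := by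
  conv_lhs => rw [fixedPoint_of_tendsto_cycleProb hν]
  have h1 : Measurable fun x : ℝ => 2 / 3 * x := by fun_prop
  rw [Measure.map_apply h1 hs, Measure.add_apply, Measure.smul_apply, Measure.smul_apply,
    Measure.conv, Measure.map_apply (by fun_prop) (h1 hs)]
  rfl

/-- A sum of two nonnegative variables vanishes only if both do, so the mass `p` at `0` solves `p =
(p + p²)/2`; `p = 1` would contradict mean 1. -/
theorem measure_singleton_zero_of_tendsto_cycleProb (hν : Tendsto cycleProb atTop (𝓝 ν)) :
    (ν : Measure ℝ) {0} = 0 := by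
  have hnn := ae_nonneg_of_measure_Iio_zero (measure_Iio_zero_of_tendsto_cycleProb hν)
  have h := measure_eq_of_tendsto_cycleProb hν (measurableSet_singleton (0 : ℝ))
  have h1 : (fun x : ℝ => 2 / 3 * x) ⁻¹' {0} = {0} := by
    ext x
    simp
  have h2 : ((ν : Measure ℝ).prod (ν : Measure ℝ))
      ((fun p : ℝ × ℝ => 2 / 3 * (p.1 + p.2)) ⁻¹' {0}) =
      (ν : Measure ℝ) {0} * (ν : Measure ℝ) {0} := by
    rw [← Measure.prod_prod]
    refine measure_congr ?_
    filter_upwards [Measure.quasiMeasurePreserving_fst.ae hnn,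
      Measure.quasiMeasurePreserving_snd.ae hnn] with p hp1 hp2
    refine propext ?_
    change 2 / 3 * (p.1 + p.2) = 0 ↔ p.1 = 0 ∧ p.2 = 0
    constructor
    · intro hp
      constructor <;> linarith
    · rintro ⟨h, h'⟩
      rw [h, h']
      norm_num
  rw [h1, h2] at h
  have hr := congrArg ENNReal.toReal h
  rw [ENNReal.toReal_add (by finiteness) (by finiteness)] at hr
  simp only [ENNReal.toReal_mul, ENNReal.toReal_inv, ENNReal.toReal_ofNat] at hr
  have h3 : ((ν : Measure ℝ) {0}).toReal * (((ν : Measure ℝ) {0}).toReal - 1) = 0 := by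
    linear_combination -2 * hr
  rcases mul_eq_zero.1 h3 with h4 | h4
  · exact ((ENNReal.toReal_eq_zero_iff _).1 h4).resolve_right (measure_ne_top _ _)
  · exfalso
    have h5 : (ν : Measure ℝ) {0} = 1 := by
      rw [← ENNReal.toReal_eq_one_iff]
      linarith
    have h6 : ∀ᵐ x ∂(ν : Measure ℝ), x ^ 1 = (0 : ℝ) := by
      have : ∀ᵐ x ∂(ν : Measure ℝ), x ∈ ({0} : Set ℝ) :=
        (prob_compl_eq_zero_iff (measurableSet_singleton _)).2 h5
      filter_upwards [this] with x hx
      simpa using hx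
    have h7 := integral_id_of_tendsto_cycleProb hν
    rw [integral_congr_ae h6, integral_zero] at h7
    exact zero_ne_one h7

theorem measure_Iic_zero_of_tendsto_cycleProb (hν : Tendsto cycleProb atTop (𝓝 ν)) :
    (ν : Measure ℝ) (Set.Iic 0) = 0 := by
  rw [← Set.Iio_union_right]
  exact measure_union_null (measure_Iio_zero_of_tendsto_cycleProb hν)
    (measure_singleton_zero_of_tendsto_cycleProb hν)

theorem mul_mem_support_of_tendsto_cycleProb (hν : Tendsto cycleProb atTop (𝓝 ν)) {x : ℝ}
    (hx : x ∈ (ν : Measure ℝ).support) : 2 / 3 * x ∈ (ν : Measure ℝ).support := by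
  rw [Measure.mem_support_iff_forall] at hx ⊢
  intro U hU
  obtain ⟨V, hVU, hV, hxV⟩ := mem_nhds_iff.1 hU
  refine lt_of_lt_of_le ?_ (measure_mono hVU)
  rw [measure_eq_of_tendsto_cycleProb hν hV.measurableSet]
  have hc : Continuous fun x : ℝ => 2 / 3 * x := by fun_prop
  exact (ENNReal.mul_pos (by simp)
    (hx _ (hc.continuousAt.preimage_mem_nhds (hV.mem_nhds hxV))).ne').trans_le le_self_add

theorem mul_add_mem_support_of_tendsto_cycleProb (hν : Tendsto cycleProb atTop (𝓝 ν)) {x y : ℝ}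
    (hx : x ∈ (ν : Measure ℝ).support) (hy : y ∈ (ν : Measure ℝ).support) :
    2 / 3 * (x + y) ∈ (ν : Measure ℝ).support := by
  rw [Measure.mem_support_iff_forall] at hx hy ⊢
  intro U hU
  obtain ⟨V, hVU, hV, hxV⟩ := mem_nhds_iff.1 hU
  refine lt_of_lt_of_le ?_ (measure_mono hVU)
  rw [measure_eq_of_tendsto_cycleProb hν hV.measurableSet]
  have hc : Continuous fun p : ℝ × ℝ => 2 / 3 * (p.1 + p.2) := by fun_prop
  have hn : (fun p : ℝ × ℝ => 2 / 3 * (p.1 + p.2)) ⁻¹' V ∈ 𝓝 (x, y) :=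
    hc.continuousAt.preimage_mem_nhds (hV.mem_nhds hxV)
  obtain ⟨A, hA, B, hB, hAB⟩ := mem_nhds_prod_iff.1 hn
  refine (ENNReal.mul_pos (by simp) ?_).trans_le le_add_self
  refine (lt_of_lt_of_le ?_ (measure_mono hAB)).ne'
  rw [Measure.prod_prod]
  exact ENNReal.mul_pos (hx A hA).ne' (hy B hB).ne'

/-- A closed set that contains a positive number and is stable under `(x, y) ↦ 2/3 (x + y)` and
`x ↦ 2/3 x` contains all positive numbers. -/
theorem Ioi_subset_of_two_thirds_mul_add_mem {S : Set ℝ} (hS : IsClosed S)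
    (hmul : ∀ x ∈ S, 2 / 3 * x ∈ S) (hadd : ∀ x ∈ S, ∀ y ∈ S, 2 / 3 * (x + y) ∈ S)
    {a : ℝ} (ha : a ∈ S) (ha0 : 0 < a) : Set.Ioi 0 ⊆ S := by
  have hpow : ∀ d : ℕ, (2 / 3 : ℝ) ^ d * a ∈ S := fun d => by
    induction d with
    | zero => simpa using ha
    | succ d ih =>
      rw [pow_succ', mul_assoc]
      exact hmul _ ih
  have hlim : Tendsto (fun d : ℕ => (2 / 3 : ℝ) ^ d * a) atTop (𝓝 0) := by
    simpa using (tendsto_pow_atTop_nhds_zero_of_lt_one (by norm_num : (0 : ℝ) ≤ 2 / 3)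
      (by norm_num)).mul_const a
  have h0 : (0 : ℝ) ∈ S := hS.mem_of_tendsto hlim (Eventually.of_forall hpow)
  have hgrid : ∀ d k : ℕ, k ≤ 2 ^ d → (k : ℝ) * ((2 / 3 : ℝ) ^ d * a) ∈ S := fun d => by
    induction d with
    | zero =>
      intro k hk
      obtain rfl | rfl : k = 0 ∨ k = 1 := by rw [pow_zero] at hk; omega
      · simpa using h0
      · simpa using ha
    | succ d ih =>
      intro k hk
      rw [pow_succ] at hk
      have := hadd _ (ih (k / 2) (by omega)) _ (ih (k - k / 2) (by omega))
      rw [← add_mul, ← Nat.cast_add, Nat.add_sub_cancel' (Nat.div_le_self k 2)] at this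
      convert this using 1
      ring
  intro z hz
  rw [Set.mem_Ioi] at hz
  rw [← hS.closure_eq, Metric.mem_closure_iff]
  intro ε hε
  have hlarge : Tendsto (fun d : ℕ => (4 / 3 : ℝ) ^ d * a) atTop atTop :=
    (tendsto_pow_atTop_atTop_of_one_lt (by norm_num)).atTop_mul_const ha0
  obtain ⟨d, hd1, hd2⟩ :=
    ((hlim.eventually (gt_mem_nhds hε)).and (hlarge.eventually_ge_atTop z)).exists
  set δ : ℝ := (2 / 3 : ℝ) ^ d * a with hδ
  have hδ0 : 0 < δ := by positivity
  have hfl : (⌊z / δ⌋₊ : ℝ) * δ ≤ z :=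
    (le_div_iff₀ hδ0).1 (Nat.floor_le (by positivity))
  have hfl' : z < ((⌊z / δ⌋₊ : ℝ) + 1) * δ := (div_lt_iff₀ hδ0).1 (Nat.lt_floor_add_one _)
  refine ⟨_, hgrid d ⌊z / δ⌋₊ ?_, ?_⟩
  · refine Nat.floor_le_of_le ?_
    rw [div_le_iff₀ hδ0, hδ]
    push_cast
    rw [← mul_assoc, ← mul_pow]
    norm_num
    exact hd2
  · rw [Real.dist_eq, abs_lt]
    constructor <;> linarith

theorem measure_pos_of_tendsto_cycleProb (hν : Tendsto cycleProb atTop (𝓝 ν)) {U : Set ℝ}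
    (hU : IsOpen U) (hU0 : (U ∩ Set.Ioi 0).Nonempty) : 0 < (ν : Measure ℝ) U := by
  have h1 : 0 < (ν : Measure ℝ) (Set.Ioi 0) := by
    rw [← Set.compl_Iic, prob_compl_eq_one_sub measurableSet_Iic,
      measure_Iic_zero_of_tendsto_cycleProb hν]
    simp
  obtain ⟨a, ha0, ha⟩ := Measure.nonempty_inter_support_of_pos h1
  obtain ⟨z, hzU, hz⟩ := hU0
  have hzS := Ioi_subset_of_two_thirds_mul_add_mem Measure.isClosed_support
    (fun x hx => mul_mem_support_of_tendsto_cycleProb hν hx)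
    (fun x hx y hy => mul_add_mem_support_of_tendsto_cycleProb hν hx hy) ha ha0 hz
  exact (Measure.mem_support_iff_forall z).1 hzS U (hU.mem_nhds hzU)

end Butterfly

theorem mainTheorem2 :
    (∀ n : ℕ, ∃ P : Sylow 2 (Equiv.Perm (Fin (2 ^ n))),
      (P : Subgroup (Equiv.Perm (Fin (2 ^ n)))) = Butterfly.butterflyGroup n) ∧
    ∃ (m : ℕ → ℝ) (ν : Measure ℝ) (_ : IsProbabilityMeasure ν),
      m 1 = 1 ∧
      (∀ k : ℕ, 2 ≤ k →
        m k = ((3 / 2 : ℝ) - 1) / ((3 / 2 : ℝ) ^ k - 3 / 2) *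
          ∑ j ∈ Finset.Ioo 0 k, (k.choose j : ℝ) * m j * m (k - j)) ∧
      ν (Set.Iic 0) = 0 ∧
      (∀ U : Set ℝ, IsOpen U → (U ∩ Set.Ioi 0).Nonempty → 0 < ν U) ∧
      (∀ k : ℕ, 1 ≤ k → Integrable (fun x : ℝ => x ^ k) ν ∧ ∫ x, x ^ k ∂ν = m k) ∧
      ∀ (Ω : ℕ → Type*) [∀ n, MeasurableSpace (Ω n)] (μ : ∀ n, Measure (Ω n))
        [∀ n, IsProbabilityMeasure (μ n)] (σ : ∀ n, Ω n → Equiv.Perm (Fin (2 ^ n))),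
        (∀ n, HasLaw (σ n)
          (uniformOn (Butterfly.butterflyGroup n : Set (Equiv.Perm (Fin (2 ^ n))))) (μ n)) →
        TendstoInDistribution
          (fun n ω => (Butterfly.numCycles (σ n ω) : ℝ) * (2 / 3 : ℝ) ^ n)
          atTop (id : ℝ → ℝ) μ ν := by
  obtain ⟨ν, hν⟩ := Butterfly.exists_tendsto_cycleProb
  refine ⟨Butterfly.exists_sylow_eq_butterflyGroup, fun k => ∫ x, x ^ k ∂(ν : Measure ℝ), ν,
    inferInstance, Butterfly.integral_id_of_tendsto_cycleProb hν,
    fun k hk => Butterfly.integral_pow_of_tendsto_cycleProb hν hk,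
    Butterfly.measure_Iic_zero_of_tendsto_cycleProb hν,
    fun U hU hU0 => Butterfly.measure_pos_of_tendsto_cycleProb hν hU hU0,
    fun k _ => ⟨(Butterfly.moments_of_tendsto_cycleProb hν k).1, rfl⟩, ?_⟩
  intro Ω _ μ _ σ hσ
  have hm : ∀ n, AEMeasurable
      (fun ω => (Butterfly.numCycles (σ n ω) : ℝ) * (2 / 3 : ℝ) ^ n) (μ n) := fun n =>
    (Butterfly.measurable_normalized_numCycles n).comp_aemeasurable (hσ n).aemeasurable
  refine ⟨hm, aemeasurable_id, ?_⟩
  have hlim : (⟨(ν : Measure ℝ).map id, Measure.isProbabilityMeasure_map aemeasurable_id⟩ :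
      ProbabilityMeasure ℝ) = ν := Subtype.ext Measure.map_id
  rw [hlim]
  refine hν.congr fun n => Subtype.ext ?_
  change Butterfly.cycleLaw n = (μ n).map ((fun ρ : Equiv.Perm (Fin (2 ^ n)) =>
    (Butterfly.numCycles ρ : ℝ) * (2 / 3 : ℝ) ^ n) ∘ σ n)
  rw [← AEMeasurable.map_map_of_aemeasurable
    (Butterfly.measurable_normalized_numCycles n).aemeasurable (hσ n).aemeasurable,
    (hσ n).map_eq]
  rfl
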